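/- Let $(\Omega,\mathcal B)$ be a measurable space. A $\sigma$-finite signed measure on $(\Omega,\mathcal B)$ is a countably additive function $\mu:\mathcal B\to[-\infty,+\infty]$ with $\mu(\emptyset)=0$ that takes at most one of the two values $+\infty$, $-\infty$ and whose total variation measure $|\mu|$ is $\sigma$-finite. Let $\mu$ and $\nu$ be $\sigma$-finite signed measures on $(\Omega,\mathcal B)$ satisfying condition $(\mathcal O)$: (i) for all $A,B\in\mathcal B$ with $\mu(A)=\mu(B)\neq\pm\infty$ one has $\nu(A)=\nu(B)\neq\pm\infty$; and (ii) for all $A,B\in\mathcal B$ with $\mu(A)\le\mu(B)$ one has $\nu(A)\le\nu(B)$. If the range $\{\mu(A):A\in\mathcal B\}$ is an interval (possibly degenerate) of the extended real line, then $\nu$ is a multiple of $\mu$: there is $\alpha\in\mathbb R$ such that $\nu(A)=\alpha\,\mu(A)$ for every $A\in\mathcal B$, with the convention $0\cdot(\pm\infty)=0$. -/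

import Mathlib

open MeasureTheory
open scoped ENNReal

namespace ExtendedSignedMeasure

/-! Extended real valued signed measures are taken to be Mathlib's countably additive set functions
`VectorMeasure Ω EReal`, together with the requirement `IsSigmaFiniteSigned` below. -/

lemma abs_eq_add (x : EReal) : x.abs = x.toENNReal + (-x).toENNReal := by
  induction x with
  | bot => simp
  | top => simp
  | coe r =>
    rw [EReal.abs_def, ← EReal.coe_neg, EReal.real_coe_toENNReal, EReal.real_coe_toENNReal]
    rcases le_total 0 r with h | h
    · rw [abs_of_nonneg h, ENNReal.ofReal_of_nonpos (p := -r) (by linarith), add_zero]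
    · rw [abs_of_nonpos h, ENNReal.ofReal_of_nonpos h, zero_add]

lemma continuous_abs : Continuous EReal.abs := by
  have h : EReal.abs = fun x : EReal => x.toENNReal + (-x).toENNReal := funext abs_eq_add
  rw [h]
  exact EReal.continuous_toENNReal.add (EReal.continuous_toENNReal.comp continuous_neg)

lemma abs_add_le (x y : EReal) : (x + y).abs ≤ x.abs + y.abs := by
  induction x with
  | bot => simp
  | top => simp
  | coe a =>
    induction y with
    | bot => simp
    | top => simp
    | coe b =>
      rw [← EReal.coe_add, EReal.abs_def, EReal.abs_def, EReal.abs_def,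
        ← ENNReal.ofReal_add (abs_nonneg a) (abs_nonneg b)]
      exact ENNReal.ofReal_le_ofReal (_root_.abs_add_le a b)

lemma abs_sum_le {ι : Type*} (s : Finset ι) (f : ι → EReal) :
    (∑ i ∈ s, f i).abs ≤ ∑ i ∈ s, (f i).abs := by
  classical
  induction s using Finset.induction_on with
  | empty => simp
  | insert a s ha ih =>
    rw [Finset.sum_insert ha, Finset.sum_insert ha]
    exact (abs_add_le _ _).trans (add_le_add le_rfl ih)

variable {Ω : Type*} [MeasurableSpace Ω]

lemma isSigmaSubadditive_abs (μ : VectorMeasure Ω EReal) :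
    IsSigmaSubadditiveSetFun (fun A : Set Ω => (μ A).abs) := by
  intro s hs
  have hsum := μ.m_iUnion (fun i => (s i).prop) hs
  refine le_of_tendsto ((continuous_abs.tendsto _).comp hsum) (Filter.Eventually.of_forall ?_)
  intro t
  exact (abs_sum_le t _).trans (ENNReal.sum_le_tsum t)

/-- The total variation `|μ|` of an extended real valued signed measure, as a measure:
`|μ|(A)` is the supremum of `∑ |μ(E)|` over all finite measurable partitions of `A`. -/
noncomputable def totalVariation (μ : VectorMeasure Ω EReal) : Measure Ω :=
  preVariation (fun A : Set Ω => (μ A).abs) (isSigmaSubadditive_abs μ) (by simp)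

/-- `μ` is a σ-finite signed measure: it takes at most one of the values `±∞`, and `|μ|` is
σ-finite. -/
def IsSigmaFiniteSigned (μ : VectorMeasure Ω EReal) : Prop :=
  ((∀ A, μ A ≠ ⊤) ∨ (∀ A, μ A ≠ ⊥)) ∧ SigmaFinite (totalVariation μ)

/-- Condition (L): sets of equal finite `μ`-measure have equal finite `ν`-measure. -/
def ConditionL (μ ν : VectorMeasure Ω EReal) : Prop :=
  ∀ A B : Set Ω, MeasurableSet A → MeasurableSet B →
    μ A = μ B → μ A ≠ ⊤ → μ A ≠ ⊥ → ν A = ν B ∧ ν A ≠ ⊤ ∧ ν A ≠ ⊥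

/-- Condition (O): condition (L), and `μ A ≤ μ B` implies `ν A ≤ ν B`. -/
def ConditionO (μ ν : VectorMeasure Ω EReal) : Prop :=
  ConditionL μ ν ∧
    ∀ A B : Set Ω, MeasurableSet A → MeasurableSet B → μ A ≤ μ B → ν A ≤ ν B

/-- The range of a signed measure: the set of its values on measurable sets. -/
def measureRange (μ : VectorMeasure Ω EReal) : Set EReal :=
  {x | ∃ A : Set Ω, MeasurableSet A ∧ μ A = x}

end ExtendedSignedMeasure

/-! After passing to negatives, `μ` omits `-∞`. Let `N` be a negative Hahn set, which is also one
for `ν` because signs are seen by comparison with `∅`. Flipping a set inside `N` turns the value of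
`μ` into that of `|μ|` minus a finite constant, and likewise for `ν`. So `|ν|` respects the order
given by `|μ|`, whose range is again an interval, and positive measures `m`, `n` suffice.

There `n A` is a monotone function of `m A`, hence differentiable somewhere, and the derivative `α`
is the limiting ratio on small sets (`exists_ratio_limit`). Bounds `p ≤ n/m ≤ q` then spread from
small sets to all finite ones (`ratioBetween_of_small`). Since `m` may have atoms, a set need not
have subsets of prescribed measure. Let `T` be the supremum of the thresholds below which the bounds
hold. If finite unions of sets smaller than `T` exceed `T`, their measures are dense enough to push
the bounds past `T`. Otherwise some `R` of measure `T` absorbs all smaller sets, and an approximate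
copy of `R` disjoint from it extends the bounds to `2 * T`. Finally σ-finiteness handles infinite
measure. -/

namespace OrderedMeasures

/-! ### Finite sets and finite unions of small sets -/

variable {Ω : Type*} [MeasurableSpace Ω] {m n : Measure Ω} {A B : Set Ω}

/-- `A` is measurable of finite measure. -/
def FiniteSet (m : Measure Ω) (A : Set Ω) : Prop := MeasurableSet A ∧ m A ≠ ∞

lemma FiniteSet.subset (hA : FiniteSet m A) (hB : MeasurableSet B) (h : B ⊆ A) :
    FiniteSet m B := ⟨hB, measure_ne_top_of_subset h hA.2⟩

lemma FiniteSet.union (hA : FiniteSet m A) (hB : FiniteSet m B) : FiniteSet m (A ∪ B) :=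
  ⟨hA.1.union hB.1, measure_union_ne_top hA.2 hB.2⟩

lemma FiniteSet.diff (hA : FiniteSet m A) (hB : MeasurableSet B) : FiniteSet m (A \ B) :=
  hA.subset (hA.1.diff hB) Set.sdiff_subset

lemma FiniteSet.inter (hA : FiniteSet m A) (hB : MeasurableSet B) : FiniteSet m (A ∩ B) :=
  hA.subset (hA.1.inter hB) Set.inter_subset_left

lemma FiniteSet.real_union (hA : FiniteSet m A) (hB : FiniteSet m B) (h : Disjoint A B) :
    m.real (A ∪ B) = m.real A + m.real B :=
  measureReal_union h hB.1 hA.2 hB.2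

lemma FiniteSet.real_diff_add_inter (hA : FiniteSet m A) (hB : MeasurableSet B) :
    m.real (A \ B) + m.real (A ∩ B) = m.real A :=
  measureReal_sdiff_add_inter hB hA.2

lemma FiniteSet.real_mono (hA : FiniteSet m A) (h : B ⊆ A) : m.real B ≤ m.real A :=
  measureReal_mono h hA.2

/-- Finite unions of sets of measure less than `T`. -/
inductive Gen (m : Measure Ω) (T : ℝ) : Set Ω → Prop
  | base {A : Set Ω} (hA : FiniteSet m A) (h : m.real A < T) : Gen m T A
  | union {A B : Set Ω} (hA : Gen m T A) (hB : Gen m T B) : Gen m T (A ∪ B)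

variable {T : ℝ}

lemma Gen.finiteSet (h : Gen m T A) : FiniteSet m A := by
  induction h with
  | base hA h => exact hA
  | union _ _ h1 h2 => exact h1.union h2

lemma Gen.subset (h : Gen m T A) (hB : MeasurableSet B) (hBA : B ⊆ A) : Gen m T B := by
  induction h generalizing B with
  | base hA h => exact .base (hA.subset hB hBA) ((hA.real_mono hBA).trans_lt h)
  | @union A₁ A₂ h1 h2 ih1 ih2 =>
    have : B = (B ∩ A₁) ∪ (B ∩ A₂) := by
      rw [← Set.inter_union_distrib_left]; exact (Set.inter_eq_left.2 hBA).symm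
    rw [this]
    exact .union (ih1 (hB.inter h1.finiteSet.1) Set.inter_subset_right)
      (ih2 (hB.inter h2.finiteSet.1) Set.inter_subset_right)

lemma Gen.diff (h : Gen m T A) (hB : MeasurableSet B) : Gen m T (A \ B) :=
  h.subset (h.finiteSet.1.diff hB) Set.sdiff_subset

/-- Two pieces below `g / 4` have a union below `g / 2`, hence below `g / 4` by the gap. So one can
descend to a generator while staying above `g / 4`. -/
lemma Gen.exists_subset_of_gap {g : ℝ} (h : Gen m T A)
    (hgap : ∀ C, MeasurableSet C → C ⊆ A → m.real C < g / 4 ∨ g ≤ m.real C)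
    (hA : g / 4 ≤ m.real A) :
    ∃ C ⊆ A, MeasurableSet C ∧ g / 4 ≤ m.real C ∧ m.real C < T := by
  induction h with
  | base hA' h => exact ⟨_, subset_rfl, hA'.1, hA, h⟩
  | @union A₁ A₂ h1 h2 ih1 ih2 =>
    by_cases c1 : g / 4 ≤ m.real A₁
    · obtain ⟨C, hC, h'⟩ := ih1 (fun C hC h => hgap C hC (h.trans Set.subset_union_left)) c1
      exact ⟨C, hC.trans Set.subset_union_left, h'⟩
    by_cases c2 : g / 4 ≤ m.real A₂
    · obtain ⟨C, hC, h'⟩ := ih2 (fun C hC h => hgap C hC (h.trans Set.subset_union_right)) c2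
      exact ⟨C, hC.trans Set.subset_union_right, h'⟩
    have := measureReal_union_le (μ := m) A₁ A₂
    rcases hgap _ (h1.union h2).finiteSet.1 subset_rfl with h | h <;> linarith

/-- If all values in `[0, T)` are attained, then the values of finite unions of sets of measure
less than `T` are dense from above. -/
lemma Gen.exists_real_mem_Ico (hrep : ∀ e, 0 ≤ e → e < T → ∃ E, FiniteSet m E ∧ m.real E = e)
    {A₀ : Set Ω} (hA₀ : Gen m T A₀) {X κ : ℝ} (hX₀ : 0 ≤ X) (hX : X ≤ m.real A₀) (hκ : 0 < κ) :
    ∃ A, Gen m T A ∧ X ≤ m.real A ∧ m.real A < X + κ := by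
  set V : Set ℝ := {x | ∃ A, Gen m T A ∧ X ≤ m.real A ∧ m.real A = x} with hV
  have hVne : V.Nonempty := ⟨_, A₀, hA₀, hX, rfl⟩
  have hVbdd : BddBelow V := ⟨X, by rintro x ⟨A, _, h, rfl⟩; exact h⟩
  have hY : ∀ A, Gen m T A → X ≤ m.real A → sInf V ≤ m.real A :=
    fun A hA h => csInf_le hVbdd ⟨A, hA, h, rfl⟩
  have hXY : X ≤ sInf V := le_csInf hVne (by rintro x ⟨A, _, h, rfl⟩; exact h)
  rcases hXY.eq_or_lt with h | hlt
  · obtain ⟨x, ⟨A, hA, hXA, rfl⟩, hx⟩ := exists_lt_of_csInf_lt hVne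
      (show sInf V < X + κ by linarith)
    exact ⟨A, hA, hXA, hx⟩
  exfalso
  set Y := sInf V
  obtain ⟨g, hg⟩ : ∃ g, g = Y - X := ⟨_, rfl⟩
  have hg0 : 0 < g := by linarith
  obtain ⟨x, ⟨A, hA, hXA, rfl⟩, hx⟩ := exists_lt_of_csInf_lt hVne
    (show sInf V < Y + g / 4 by linarith)
  have hYA := hY A hA hXA
  -- Removing `C` from `A` cannot land in the empty gap `[X, Y)`, so it costs either very little or
  -- more than `g`.
  have key : ∀ C, MeasurableSet C → C ⊆ A → m.real C < g / 4 ∨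
      g ≤ m.real C ∧ m.real A - m.real C < X := by
    intro C hC hCA
    have h1 := hA.finiteSet.real_diff_add_inter hC
    rw [Set.inter_eq_right.2 hCA] at h1
    by_cases h : X ≤ m.real (A \ C)
    · have := hY _ (hA.diff hC) h
      left; linarith
    · right; constructor <;> linarith
  obtain ⟨C₁, hC₁A, hC₁, hC₁g, hC₁T⟩ := hA.exists_subset_of_gap
    (fun C hC h => (key C hC h).imp_right And.left) (show g / 4 ≤ m.real A by linarith)
  set W : Set ℝ := {x | ∃ C ⊆ A, MeasurableSet C ∧ g / 4 ≤ m.real C ∧ m.real C = x} with hW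
  have hWbdd : BddBelow W := ⟨g / 4, by rintro x ⟨C, _, _, h, rfl⟩; exact h⟩
  have hWle : ∀ C ⊆ A, MeasurableSet C → g / 4 ≤ m.real C → sInf W ≤ m.real C :=
    fun C h hC h' => csInf_le hWbdd ⟨C, h, hC, h', rfl⟩
  have hc₀ := hWle C₁ hC₁A hC₁ hC₁g
  -- A nearly minimal non-negligible piece of `A`; if the near-minimizer is not below `T`, then `C₁`
  -- is smaller still.
  obtain ⟨C, hCA, hC, hCg, hCT, hCc⟩ : ∃ C ⊆ A, MeasurableSet C ∧ g / 4 ≤ m.real C ∧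
      m.real C < T ∧ m.real C < sInf W + g / 4 := by
    obtain ⟨x, ⟨C, hCA, hC, hCg, rfl⟩, hx⟩ := exists_lt_of_csInf_lt (s := W)
      ⟨_, C₁, hC₁A, hC₁, hC₁g, rfl⟩ (show sInf W < sInf W + g / 4 by linarith)
    by_cases h : m.real C < T
    · exact ⟨C, hCA, hC, hCg, h, hx⟩
    · exact ⟨C₁, hC₁A, hC₁, hC₁g, hC₁T, by linarith⟩
  have hCX : m.real A - m.real C < X := by
    rcases key C hC hCA with h | h
    · linarith
    · exact h.2
  -- Exchange `C` for `E`, aiming at the middle of the gap. As `E` is smaller than `C` by at least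
  -- `g / 2`, near-minimality makes `E ∩ A` negligible, so `(A \ C) ∪ (E \ A)` has measure strictly
  -- between `X` and `Y`.
  obtain ⟨E, hE, hEe⟩ := hrep (X + g / 2 - (m.real A - m.real C)) (by linarith) (by linarith)
  have hEA : m.real (E ∩ A) < g / 4 := by
    by_contra! h
    have h1 := hWle _ Set.inter_subset_right (hE.1.inter hA.finiteSet.1) h
    have h2 := hE.real_mono (B := E ∩ A) Set.inter_subset_left
    linarith
  have h1 := hE.real_diff_add_inter hA.finiteSet.1
  have h2 := hA.finiteSet.real_diff_add_inter hC
  rw [Set.inter_eq_right.2 hCA] at h2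
  have h3 := (hA.finiteSet.diff hC).real_union (hE.diff hA.finiteSet.1)
    (Set.disjoint_sdiff_right.mono_left Set.sdiff_subset)
  have h4 := hY _ ((hA.diff hC).union ((Gen.base hE (by linarith)).diff hA.finiteSet.1))
    (by linarith)
  have h5 := measureReal_nonneg (μ := m) (s := E ∩ A)
  linarith

/-! ### Order-compatible pairs of positive measures -/

/-- A pair of measures such that the first has an interval as its range, and orders sets in a way
which is respected by the second. -/
structure OrderCompatible (m n : Measure Ω) : Prop where
  mono : ∀ A B, MeasurableSet A → MeasurableSet B → m A ≤ m B → n A ≤ n B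
  ne_top : ∀ A, MeasurableSet A → m A ≠ ∞ → n A ≠ ∞
  exists_eq : ∀ A t, MeasurableSet A → t ≤ m A → ∃ B, MeasurableSet B ∧ m B = t

namespace OrderCompatible

lemma finiteSet (h : OrderCompatible m n) (hA : FiniteSet m A) : FiniteSet n A := ⟨hA.1, h.ne_top A hA.1 hA.2⟩

lemma real_mono (h : OrderCompatible m n) (hA : FiniteSet m A) (hB : FiniteSet m B) (hAB : m.real A ≤ m.real B) :
    n.real A ≤ n.real B :=
  ENNReal.toReal_mono (h.finiteSet hB).2
    (h.mono A B hA.1 hB.1 ((ENNReal.toReal_le_toReal hA.2 hB.2).1 hAB))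

lemma real_congr (h : OrderCompatible m n) (hA : FiniteSet m A) (hB : FiniteSet m B) (hAB : m.real A = m.real B) :
    n.real A = n.real B :=
  le_antisymm (h.real_mono hA hB hAB.le) (h.real_mono hB hA hAB.ge)

lemma exists_real_eq (h : OrderCompatible m n) (hA : FiniteSet m A) {t : ℝ} (ht₀ : 0 ≤ t) (ht : t ≤ m.real A) :
    ∃ B, FiniteSet m B ∧ m.real B = t := by
  obtain ⟨B, hB, hBt⟩ := h.exists_eq A (ENNReal.ofReal t) hA.1
    (ENNReal.ofReal_le_of_le_toReal ht)
  exact ⟨B, ⟨hB, by simp [hBt]⟩, by simp [measureReal_def, hBt, ht₀]⟩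

lemma real_eq_zero (h : OrderCompatible m n) (hA : FiniteSet m A) (h0 : m.real A = 0) : n.real A = 0 := by
  have := h.real_congr hA (B := ∅) ⟨.empty, by simp⟩ (by simpa using h0)
  simpa using this

end OrderCompatible

/-! ### Extending ratio bounds from small sets to finite sets -/

/-- The ratio of the `n`-measure to the `m`-measure of `A` lies between `p` and `q`. -/
def RatioBetween (m n : Measure Ω) (p q : ℝ) (A : Set Ω) : Prop :=
  p * m.real A ≤ n.real A ∧ n.real A ≤ q * m.real A

variable {p q : ℝ}

lemma RatioBetween.union (h : OrderCompatible m n) (hA : FiniteSet m A) (hB : FiniteSet m B)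
    (hd : Disjoint A B) (h1 : RatioBetween m n p q A) (h2 : RatioBetween m n p q B) :
    RatioBetween m n p q (A ∪ B) := by
  unfold RatioBetween at *
  rw [hA.real_union hB hd, (h.finiteSet hA).real_union (h.finiteSet hB) hd]
  constructor <;> linarith

lemma Gen.ratioBetween (h : OrderCompatible m n)
    (hT : ∀ A, FiniteSet m A → m.real A < T → RatioBetween m n p q A) (hA : Gen m T A) :
    RatioBetween m n p q A := by
  -- Strengthened to subsets, so that overlapping unions can be made disjoint.
  suffices H : ∀ C ⊆ A, MeasurableSet C → RatioBetween m n p q C from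
    H A subset_rfl hA.finiteSet.1
  induction hA with
  | base hA h => exact fun C hCA hC => hT C (hA.subset hC hCA) ((hA.real_mono hCA).trans_lt h)
  | @union A B hA hB ihA ihB =>
    intro C hCAB hC
    have hA' := hA.finiteSet
    have hB' := hB.finiteSet
    have hC' : FiniteSet m C := (hA'.union hB').subset hC hCAB
    rw [← Set.inter_union_sdiff C A]
    exact .union h (hC'.inter hA'.1) (hC'.diff hA'.1)
      (Set.disjoint_sdiff_right.mono_left Set.inter_subset_right)
      (ihA _ Set.inter_subset_right (hC.inter hA'.1))
      (ihB _ (Set.sdiff_subset_iff.2 hCAB) (hC.diff hA'.1))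

/-- Sets of measure less than that of a finite union of sets of measure less than `T` inherit the
bounds on the ratio. -/
lemma ratioBetween_of_lt_gen (h : OrderCompatible m n) (hT₀ : 0 < T)
    (hrep : ∀ e, 0 ≤ e → e < T → ∃ E, FiniteSet m E ∧ m.real E = e)
    (hT : ∀ A, FiniteSet m A → m.real A < T → RatioBetween m n p q A)
    {C : Set Ω} (hC : Gen m T C) (hA : FiniteSet m A) (hAC : m.real A < m.real C) :
    RatioBetween m n p q A := by
  by_cases hAT : m.real A < T
  · exact hT A hA hAT
  push Not at hAT
  -- Compare `A` with finite unions of measure slightly below it for the lower bound, slightly above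
  -- it for the upper bound.
  constructor
  · refine le_of_forall_pos_sub_le fun ε hε => ?_
    obtain ⟨κ, hκ, hκA, hκε⟩ : ∃ κ, 0 < κ ∧ κ < m.real A ∧ |p| * κ ≤ ε := by
      refine ⟨min (T / 2) (ε / (|p| + 1)), by positivity, ?_, ?_⟩
      · exact (min_le_left _ _).trans_lt (by linarith)
      · calc |p| * min (T / 2) (ε / (|p| + 1)) ≤ (|p| + 1) * (ε / (|p| + 1)) := by
              gcongr
              · linarith
              · exact min_le_right _ _
          _ = ε := by field_simp
    obtain ⟨D, hD, h1, h2⟩ := Gen.exists_real_mem_Ico hrep hC (X := m.real A - κ) (κ := κ)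
      (by linarith) (by linarith) hκ
    have h3 := (hD.ratioBetween h hT).1
    have h4 := h.real_mono hD.finiteSet hA (by linarith)
    have h5 : |p * (m.real A - m.real D)| ≤ |p| * κ := by
      rw [abs_mul, abs_of_pos (a := m.real A - m.real D) (by linarith)]
      gcongr
      linarith
    have h6 := abs_le.1 h5
    linarith
  · refine le_of_forall_pos_le_add fun ε hε => ?_
    obtain ⟨κ, hκ, hκε⟩ : ∃ κ, 0 < κ ∧ |q| * κ ≤ ε := by
      refine ⟨ε / (|q| + 1), by positivity, ?_⟩
      calc |q| * (ε / (|q| + 1)) ≤ (|q| + 1) * (ε / (|q| + 1)) := by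
              gcongr
              linarith
          _ = ε := by field_simp
    obtain ⟨D, hD, h1, h2⟩ := Gen.exists_real_mem_Ico hrep hC (X := m.real A) (κ := κ)
      (by linarith) (by linarith) hκ
    have h3 := (hD.ratioBetween h hT).2
    have h4 := h.real_mono hA hD.finiteSet h1
    have h5 : |q * (m.real D - m.real A)| ≤ |q| * κ := by
      rw [abs_mul, abs_of_nonneg (a := m.real D - m.real A) (by linarith)]
      gcongr
      linarith
    have h6 := abs_le.1 h5
    linarith

/-- If finite unions of sets of measure less than `T` have measure at most `T`, then there is a
set of measure `T` which almost contains every set of measure less than `T`. -/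
lemma exists_maximal (h : OrderCompatible m n) (hT₀ : 0 < T)
    (hrep : ∀ e, 0 ≤ e → e < T → ∃ E, FiniteSet m E ∧ m.real E = e)
    (hT : ∀ A, FiniteSet m A → m.real A < T → RatioBetween m n p q A)
    (hgen : ∀ C, Gen m T C → m.real C ≤ T) :
    ∃ R, FiniteSet m R ∧ m.real R = T ∧ RatioBetween m n p q R ∧
      ∀ E, FiniteSet m E → m.real E < T → m.real (E \ R) = 0 := by
  -- `R` is the union of sets with measures tending to `T`; its finite stages are squeezed between
  -- these measures and `T`.
  obtain ⟨u, hu, huT, hulim⟩ := exists_seq_strictMono_tendsto' hT₀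
  choose D hD hDu using fun k => hrep (u k) (huT k).1.le (huT k).2
  set B : ℕ → Set Ω := fun k => ⋃ i ∈ Finset.range (k + 1), D i with hB
  have hBsucc : ∀ k, B (k + 1) = B k ∪ D (k + 1) := by
    intro k
    simp only [hB]
    rw [Finset.range_add_one (n := k + 1), Finset.set_biUnion_insert, Set.union_comm]
  have hBgen : ∀ k, Gen m T (B k) := by
    intro k
    induction k with
    | zero => simpa [hB] using Gen.base (hD 0) (by rw [hDu]; exact (huT 0).2)
    | succ k ih =>
      rw [hBsucc]
      exact ih.union (.base (hD _) (by rw [hDu]; exact (huT _).2))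
  have hDB : ∀ k, D k ⊆ B k := fun k =>
    Set.subset_biUnion_of_mem (u := D) (by simp : k ∈ Finset.range (k + 1))
  have hBmono : Monotone B := monotone_nat_of_le_succ fun k => by
    rw [hBsucc]; exact Set.subset_union_left
  have hBlim : Filter.Tendsto (fun k => m.real (B k)) Filter.atTop (nhds T) :=
    tendsto_of_tendsto_of_tendsto_of_le_of_le hulim tendsto_const_nhds
      (fun k => by
        have := (hBgen k).finiteSet.real_mono (hDB k)
        rwa [hDu] at this) (fun k => hgen _ (hBgen k))
  have hmB : Filter.Tendsto (fun k => m (B k)) Filter.atTop (nhds (m (⋃ k, B k))) :=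
    tendsto_measure_iUnion_atTop hBmono
  have hmR : m (⋃ k, B k) = ENNReal.ofReal T := by
    refine tendsto_nhds_unique hmB ?_
    have := (ENNReal.continuous_ofReal.tendsto T).comp hBlim
    refine this.congr fun k => ?_
    simp [measureReal_def, (hBgen k).finiteSet.2]
  have hR : FiniteSet m (⋃ k, B k) :=
    ⟨.iUnion fun k => (hBgen k).finiteSet.1, by simp [hmR]⟩
  have hmR' : m.real (⋃ k, B k) = T := by simp [measureReal_def, hmR, hT₀.le]
  have hnB : Filter.Tendsto (fun k => n.real (B k)) Filter.atTop (nhds (n.real (⋃ k, B k))) :=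
    (ENNReal.tendsto_toReal (h.finiteSet hR).2).comp (tendsto_measure_iUnion_atTop hBmono)
  refine ⟨_, hR, hmR', ⟨?_, ?_⟩, fun E hE hET => ?_⟩
  · rw [hmR']
    exact le_of_tendsto_of_tendsto' (hBlim.const_mul p) hnB
      fun k => ((hBgen k).ratioBetween h hT).1
  · rw [hmR']
    exact le_of_tendsto_of_tendsto' hnB (hBlim.const_mul q)
      fun k => ((hBgen k).ratioBetween h hT).2
  · refine le_antisymm ?_ measureReal_nonneg
    refine ge_of_tendsto' (x := Filter.atTop) (f := fun k => T - m.real (B k))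
      (by simpa using hBlim.const_sub T) fun k => ?_
    -- Adjoining `E` to a stage still cannot exceed `T`, so only `T - m.real (B k)` is left for the
    -- part outside.
    have h1 := hgen _ ((hBgen k).union (.base hE hET))
    rw [← Set.union_sdiff_self, (hBgen k).finiteSet.real_union
      (hE.diff (hBgen k).finiteSet.1) Set.disjoint_sdiff_right] at h1
    have h2 := (hE.diff (hBgen k).finiteSet.1).real_mono
      (Set.sdiff_subset_sdiff_right (s := E) (Set.subset_iUnion B k))
    linarith

/-- Right continuity of `n` as a function of `m` beyond a set `R` of measure `T` which almost
contains all sets of smaller measure. -/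
lemma exists_disjoint_near (h : OrderCompatible m n) (hT₀ : 0 < T) {R A₀ : Set Ω}
    (hR : FiniteSet m R) (hRT : m.real R = T)
    (hsmall : ∀ E, FiniteSet m E → m.real E < T → m.real (E \ R) = 0)
    (hA₀ : FiniteSet m A₀) (hTA₀ : T < m.real A₀) {κ : ℝ} (hκ : 0 < κ) :
    ∃ A, FiniteSet m A ∧ Disjoint A R ∧ T ≤ m.real A ∧ m.real A < T + κ ∧
      n.real A ≤ n.real R + κ := by
  have hdisj : ∀ X, T < X → X ≤ m.real A₀ →
      ∃ A, FiniteSet m A ∧ Disjoint A R ∧ T ≤ m.real A ∧ m.real A ≤ X := by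
    intro X hTX hX
    obtain ⟨A, hA, rfl⟩ := h.exists_real_eq hA₀ (hT₀.trans hTX).le hX
    refine ⟨A \ R, hA.diff hR.1, Set.disjoint_sdiff_left, ?_, hA.real_mono Set.sdiff_subset⟩
    by_contra! hlt
    have h1 := hsmall _ (hA.diff hR.1) hlt
    rw [sdiff_idem] at h1
    have h2 := hA.real_diff_add_inter hR.1
    have h3 := hR.real_mono (B := A ∩ R) Set.inter_subset_right
    linarith
  by_cases hex : ∃ A, FiniteSet m A ∧ Disjoint A R ∧ m.real A = T
  · obtain ⟨A, hA, hAR, hAT⟩ := hex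
    refine ⟨A, hA, hAR, hAT.ge, by linarith, ?_⟩
    have := h.real_congr hA hR (hAT.trans hRT.symm)
    linarith
  have hstrict : ∀ X, T < X →
      ∃ A, FiniteSet m A ∧ Disjoint A R ∧ T < m.real A ∧ m.real A ≤ X := by
    intro X hTX
    obtain ⟨A, hA, hAR, h1, h2⟩ := hdisj (min X (m.real A₀)) (lt_min hTX hTA₀) (min_le_right _ _)
    exact ⟨A, hA, hAR, h1.lt_of_ne fun h' => hex ⟨A, hA, hAR, h'.symm⟩, h2.trans (min_le_left _ _)⟩
  -- `sInf V` plays the role of the right limit of `n` at `T`. The sets below satisfy `n A₃ < sInf V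
  -- + κ` and `n A₁ ≥ sInf V`; comparing `A₁ ∪ A₂` with `A₃ ∪ R` gives `n A₂ ≤ n R + κ`.
  set V : Set ℝ := {x | ∃ A, FiniteSet m A ∧ T < m.real A ∧ n.real A = x}
  have hVbdd : BddBelow V := ⟨0, by rintro x ⟨A, _, _, rfl⟩; exact measureReal_nonneg⟩
  obtain ⟨x, ⟨A, hA, hTA, rfl⟩, hx⟩ := exists_lt_of_csInf_lt (s := V) ⟨_, A₀, hA₀, hTA₀, rfl⟩
    (show sInf V < sInf V + κ by linarith)
  obtain ⟨A₃, hA₃, hA₃R, hTA₃, hA₃X⟩ := hstrict (min (m.real A) (T + min (κ / 2) (T / 2)))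
    (lt_min hTA (by linarith [lt_min (half_pos hκ) (half_pos hT₀)]))
  have h3 := (h.real_mono hA₃ hA (hA₃X.trans (min_le_left _ _)))
  have h3' := hA₃X.trans (min_le_right _ _)
  have h4 := min_le_left (κ / 2) (T / 2)
  have h4' := min_le_right (κ / 2) (T / 2)
  obtain ⟨A₂, hA₂, hA₂R, hTA₂, hA₂X⟩ := hstrict (T + (m.real A₃ - T) / 2) (by linarith)
  obtain ⟨A₁, hA₁, hA₁R, hTA₁, hA₁X⟩ := hstrict (T + (m.real A₂ - T) / 2) (by linarith)
  refine ⟨A₂, hA₂, hA₂R, hTA₂.le, by linarith, ?_⟩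
  -- Off `R`, sets smaller than `T` are null. If the intersection reached `T`, then `A₂ \ A₁` would
  -- be null, contradicting `m A₁ < m A₂`.
  have hnull : m.real (A₂ ∩ A₁) = 0 := by
    have hnull' : ∀ E, MeasurableSet E → E ⊆ A₂ → m.real E < T → m.real E = 0 := by
      intro E hE hEA hET
      have := hsmall E (hA₂.subset hE hEA) hET
      rwa [(hA₂R.mono_left hEA).sdiff_eq_left] at this
    by_contra h0
    have h1 : T ≤ m.real (A₂ ∩ A₁) := by
      by_contra! hlt
      exact h0 (hnull' _ (hA₂.1.inter hA₁.1) Set.inter_subset_left hlt)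
    have h2 := hA₂.real_diff_add_inter hA₁.1
    have h5 := hA₁.real_mono (B := A₂ ∩ A₁) Set.inter_subset_right
    have h6 := hnull' _ (hA₂.1.diff hA₁.1) Set.sdiff_subset (by linarith)
    linarith
  have hn0 := h.real_eq_zero (hA₂.inter hA₁.1) hnull
  have e1 := hA₂.real_diff_add_inter hA₁.1
  have e2 := (h.finiteSet hA₂).real_diff_add_inter hA₁.1
  have e3 := hA₁.real_union (hA₂.diff hA₁.1) Set.disjoint_sdiff_right
  have e4 := (h.finiteSet hA₁).real_union (h.finiteSet (hA₂.diff hA₁.1)) Set.disjoint_sdiff_right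
  have e5 := hA₃.real_union hR hA₃R
  have e6 := (h.finiteSet hA₃).real_union (h.finiteSet hR) hA₃R
  have e7 := h.real_mono (hA₁.union (hA₂.diff hA₁.1)) (hA₃.union hR) (by linarith)
  have e8 : sInf V ≤ n.real A₁ := csInf_le hVbdd ⟨A₁, hA₁, hTA₁, rfl⟩
  linarith

/-- A set of measure between `T` and `2 * T` matches in measure a near-copy `A'` of `R` off `R`
together with a set `E` smaller than `T`. Almost all of `E` lies in `R`, so the two parts are
essentially disjoint and their bounds add. -/
lemma ratioBetween_lt_two_mul (h : OrderCompatible m n) (hT₀ : 0 < T) {R A₀ : Set Ω}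
    (hT : ∀ A, FiniteSet m A → m.real A < T → RatioBetween m n p q A)
    (hR : FiniteSet m R) (hRT : m.real R = T) (hRr : RatioBetween m n p q R)
    (hsmall : ∀ E, FiniteSet m E → m.real E < T → m.real (E \ R) = 0)
    (hA₀ : FiniteSet m A₀) (hTA₀ : T < m.real A₀)
    (hA : FiniteSet m A) (hA2 : m.real A < 2 * T) : RatioBetween m n p q A := by
  rcases lt_trichotomy (m.real A) T with hlt | heq | hgt
  · exact hT A hA hlt
  · have := h.real_congr hA hR (heq.trans hRT.symm)
    unfold RatioBetween at *
    rwa [this, heq, ← hRT]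
  obtain ⟨x, hx⟩ : ∃ x, x = m.real A - T := ⟨_, rfl⟩
  have approx : ∀ ε > 0, p * m.real A ≤ n.real A + ε ∧ n.real A ≤ q * m.real A + ε := by
    intro ε hε
    obtain ⟨κ, hκ, hκx, hκε⟩ : ∃ κ, 0 < κ ∧ κ ≤ x ∧ (|p| + |q| + 1) * κ ≤ ε := by
      refine ⟨min x (ε / (|p| + |q| + 1)), lt_min (by linarith) (by positivity),
        min_le_left _ _, ?_⟩
      calc (|p| + |q| + 1) * min x (ε / (|p| + |q| + 1))
          ≤ (|p| + |q| + 1) * (ε / (|p| + |q| + 1)) := by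
            gcongr
            exact min_le_right _ _
        _ = ε := by field_simp
    obtain ⟨A', hA', hA'R, h1, h2, h3⟩ := exists_disjoint_near h hT₀ hR hRT hsmall hA₀ hTA₀ hκ
    obtain ⟨E, hE, hEx⟩ := h.exists_real_eq hA (t := m.real A - m.real A') (by linarith)
      (by linarith)
    have hEr := hT E hE (by linarith)
    have hn0 : m.real (E ∩ A') = 0 := by
      have := hsmall E hE (by linarith)
      refine le_antisymm (this ▸ (hE.diff hR.1).real_mono ?_) measureReal_nonneg
      exact fun y hy => ⟨hy.1, hA'R.notMem_of_mem_left hy.2⟩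
    have hn0' := h.real_eq_zero (hE.inter hA'.1) hn0
    have e1 := hE.real_diff_add_inter hA'.1
    have e2 := (h.finiteSet hE).real_diff_add_inter hA'.1
    have e3 := hA'.real_union (hE.diff hA'.1) Set.disjoint_sdiff_right
    have e4 := (h.finiteSet hA').real_union (h.finiteSet (hE.diff hA'.1))
      Set.disjoint_sdiff_right
    have e5 := h.real_congr hA (hA'.union (hE.diff hA'.1)) (by linarith)
    have e6 := h.real_mono hR hA' (by linarith)
    have b : ∀ r : ℝ, |r| ≤ |p| + |q| → |r * (m.real A' - T)| ≤ (|p| + |q|) * κ := by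
      intro r hr
      rw [abs_mul, abs_of_nonneg (a := m.real A' - T) (by linarith)]
      gcongr
      linarith
    have b1 := abs_le.1 (b p (by linarith [abs_nonneg q]))
    have b2 := abs_le.1 (b q (by linarith [abs_nonneg p]))
    obtain ⟨r1, r2⟩ := hEr
    obtain ⟨r3, r4⟩ := hRr
    rw [hEx] at r1 r2
    rw [hRT] at r3 r4
    constructor <;> linarith
  exact ⟨le_of_forall_pos_le_add fun ε hε => (approx ε hε).1,
    le_of_forall_pos_le_add fun ε hε => (approx ε hε).2⟩

/-- Bounds on the ratio of the measures of small sets extend to all sets of finite measure. -/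
theorem ratioBetween_of_small (h : OrderCompatible m n) {δ : ℝ} (hδ : 0 < δ)
    (hsm : ∀ A, FiniteSet m A → m.real A < δ → RatioBetween m n p q A)
    (hA : FiniteSet m A) : RatioBetween m n p q A := by
  by_contra hbad
  set S : Set ℝ := {t | ∀ A, FiniteSet m A → m.real A < t → RatioBetween m n p q A}
  have hub : ∀ t ∈ S, t ≤ m.real A := fun t ht => by
    by_contra! hlt
    exact hbad (ht A hA hlt)
  have hbdd : BddAbove S := ⟨_, hub⟩
  have hδS : δ ≤ sSup S := le_csSup hbdd hsm
  have hTA : sSup S ≤ m.real A := csSup_le ⟨δ, hsm⟩ hub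
  obtain ⟨T, hTS⟩ : ∃ T, T = sSup S := ⟨_, rfl⟩
  rw [← hTS] at hδS hTA
  have hT₀ : 0 < T := hδ.trans_le hδS
  have hT : ∀ A, FiniteSet m A → m.real A < T → RatioBetween m n p q A := by
    intro B hB hBT
    obtain ⟨t, ht, hBt⟩ := exists_lt_of_lt_csSup (s := S) ⟨δ, hsm⟩ (hTS ▸ hBT)
    exact ht B hB hBt
  have hmax : ∀ t, (∀ A, FiniteSet m A → m.real A < t → RatioBetween m n p q A) → t ≤ T :=
    fun t ht => hTS ▸ le_csSup hbdd ht
  have hrep : ∀ e, 0 ≤ e → e < T → ∃ E, FiniteSet m E ∧ m.real E = e :=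
    fun e he heT => h.exists_real_eq hA he (heT.le.trans hTA)
  have hgen : ∀ C, Gen m T C → m.real C ≤ T := fun C hC =>
    hmax _ fun B hB hBC => ratioBetween_of_lt_gen h hT₀ hrep hT hC hB hBC
  obtain ⟨R, hR, hRT, hRr, hsmall⟩ := exists_maximal h hT₀ hrep hT hgen
  rcases hTA.eq_or_lt with heq | hlt
  · have := h.real_congr hA hR (heq.symm.trans hRT.symm)
    apply hbad
    unfold RatioBetween at *
    rwa [this, ← heq, ← hRT]
  · have := hmax (2 * T) fun B hB hB2 =>
      ratioBetween_lt_two_mul h hT₀ hT hR hRT hRr hsmall hA hlt hB hB2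
    linarith

/-! ### The limiting ratio and proportionality of positive measures -/

/-- The ratio of the measures of small sets converges. -/
lemma exists_ratio_limit (h : OrderCompatible m n) {A₀ : Set Ω} (hA₀ : FiniteSet m A₀)
    (h₀ : 0 < m.real A₀) : ∃ α : ℝ, ∀ ε > 0, ∃ δ > 0, ∀ A, FiniteSet m A → m.real A < δ →
      RatioBetween m n (α - ε) (α + ε) A := by
  obtain ⟨M, hM⟩ : ∃ M, M = m.real A₀ := ⟨_, rfl⟩
  rw [← hM] at h₀
  have hrep : ∀ t : ℝ, ∃ S, t ∈ Set.Ioo 0 M → FiniteSet m S ∧ m.real S = t := by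
    intro t
    by_cases ht : t ∈ Set.Ioo 0 M
    · obtain ⟨S, hS⟩ := h.exists_real_eq hA₀ ht.1.le (ht.2.le.trans hM.le)
      exact ⟨S, fun _ => hS⟩
    · exact ⟨∅, fun h => absurd h ht⟩
  choose S hS using hrep
  set f : ℝ → ℝ := fun t => n.real (S t) with hf
  have hval : ∀ B, FiniteSet m B → m.real B ∈ Set.Ioo 0 M → n.real B = f (m.real B) :=
    fun B hB hBM => h.real_congr hB (hS _ hBM).1 (hS _ hBM).2.symm
  have hmono : MonotoneOn f (Set.Ioo 0 M) := fun s hs t ht hst =>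
    h.real_mono (hS s hs).1 (hS t ht).1 (by rwa [(hS s hs).2, (hS t ht).2])
  -- Lebesgue: a monotone function is differentiable almost everywhere.
  obtain ⟨x, hx, hdiff⟩ : ∃ x ∈ Set.Ioo 0 M, DifferentiableAt ℝ f x := by
    by_contra! hcon
    have h1 := hmono.ae_differentiableWithinAt_of_mem
    have h2 : volume (Set.Ioo 0 M) = 0 := by
      refine measure_mono_null (t := {x | ¬ _}) ?_ h1
      intro x hx hx'
      exact hcon x hx ((hx' hx).differentiableAt (isOpen_Ioo.mem_nhds hx))
    simp at h2
    linarith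
  refine ⟨deriv f x, fun ε hε => ?_⟩
  have hd := (hasDerivAt_iff_isLittleO.1 hdiff.hasDerivAt).def hε
  obtain ⟨η, hη, hηx⟩ := Metric.eventually_nhds_iff.1
    (hd.and (isOpen_Ioo.mem_nhds hx))
  obtain ⟨hSx, hSx'⟩ := hS x hx
  -- A small `A` is split along `S x`: adding `A \ S x` and removing `A ∩ S x` are two increments of
  -- `f` at `x`, each estimated by the derivative.
  refine ⟨η, hη, fun A hA hAη => ?_⟩
  have e1 := hA.real_diff_add_inter hSx.1
  have e2 := (h.finiteSet hA).real_diff_add_inter hSx.1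
  have e3 := hSx.real_union (hA.diff hSx.1) Set.disjoint_sdiff_right
  have e4 := (h.finiteSet hSx).real_union (h.finiteSet (hA.diff hSx.1)) Set.disjoint_sdiff_right
  have e5 := hSx.real_diff_add_inter hA.1
  have e6 := (h.finiteSet hSx).real_diff_add_inter hA.1
  rw [Set.inter_comm] at e5 e6
  have n1 := measureReal_nonneg (μ := m) (s := A ∩ S x)
  have n2 := measureReal_nonneg (μ := m) (s := A \ S x)
  obtain ⟨d1, d1'⟩ := hηx (y := m.real (S x ∪ A \ S x)) (by
    rw [Real.dist_eq, abs_of_nonneg] <;> linarith)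
  obtain ⟨d2, d2'⟩ := hηx (y := m.real (S x \ A)) (by
    rw [Real.dist_eq, abs_of_nonpos] <;> linarith)
  rw [← hval _ (hSx.union (hA.diff hSx.1)) d1'] at d1
  rw [← hval _ (hSx.diff hA.1) d2'] at d2
  have d3 : m.real (S x ∪ A \ S x) - x = m.real (A \ S x) := by linarith
  have d4 : m.real (S x \ A) - x = - m.real (A ∩ S x) := by linarith
  simp only [Real.norm_eq_abs, smul_eq_mul, d3, d4, abs_neg, abs_of_nonneg n1,
    abs_of_nonneg n2] at d1 d2
  have d5 := abs_le.1 d1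
  have d6 := abs_le.1 d2
  have hfx : f x = n.real (S x) := rfl
  rw [hfx] at d5 d6
  unfold RatioBetween
  rw [← e1, ← e2]
  constructor <;> linarith

/-- If `m` is σ-finite, its range is an interval and `n` respects the order of sets given by `m`,
then `n` is a multiple of `m`. -/
theorem OrderCompatible.exists_eq_smul [SigmaFinite m] (h : OrderCompatible m n) :
    ∃ α : ℝ, 0 ≤ α ∧ ∀ A, MeasurableSet A → n A = ENNReal.ofReal α * m A := by
  obtain ⟨α, hα, hfin⟩ : ∃ α : ℝ, 0 ≤ α ∧ ∀ A, FiniteSet m A → n.real A = α * m.real A := by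
    by_cases hex : ∃ A₀, FiniteSet m A₀ ∧ 0 < m.real A₀
    · obtain ⟨A₀, hA₀, h₀⟩ := hex
      obtain ⟨α, hα⟩ := exists_ratio_limit h hA₀ h₀
      have heq : ∀ A, FiniteSet m A → n.real A = α * m.real A := by
        intro A hA
        have hb : ∀ ε > 0, RatioBetween m n (α - ε) (α + ε) A := fun ε hε => by
          obtain ⟨δ, hδ, hsm⟩ := hα ε hε
          exact ratioBetween_of_small h hδ hsm hA
        have hε : ∀ ε > 0, 0 < ε / (m.real A + 1) ∧ ε / (m.real A + 1) * m.real A ≤ ε := by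
          intro ε hε
          have := measureReal_nonneg (μ := m) (s := A)
          refine ⟨by positivity, ?_⟩
          rw [div_mul_eq_mul_div, div_le_iff₀ (by positivity)]
          nlinarith
        refine le_antisymm (le_of_forall_pos_le_add fun ε h0 => ?_)
          (le_of_forall_pos_le_add fun ε h0 => ?_)
        · have := (hb _ (hε ε h0).1).2
          linarith [(hε ε h0).2]
        · have := (hb _ (hε ε h0).1).1
          linarith [(hε ε h0).2]
      refine ⟨α, ?_, heq⟩
      have := heq A₀ hA₀
      have h1 := measureReal_nonneg (μ := n) (s := A₀)
      rw [this] at h1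
      exact nonneg_of_mul_nonneg_left h1 h₀
    · push Not at hex
      refine ⟨0, le_rfl, fun A hA => ?_⟩
      rw [h.real_eq_zero hA (le_antisymm (hex A hA) measureReal_nonneg), zero_mul]
  refine ⟨α, hα, fun A hA => ?_⟩
  have hE : ∀ k, n (A ∩ spanningSets m k) = ENNReal.ofReal α * m (A ∩ spanningSets m k) := by
    intro k
    have hF : FiniteSet m (A ∩ spanningSets m k) :=
      ⟨hA.inter (measurableSet_spanningSets m k),
        measure_ne_top_of_subset Set.inter_subset_right (measure_spanningSets_lt_top m k).ne⟩
    rw [← ofReal_measureReal (h.finiteSet hF).2, ← ofReal_measureReal hF.2, hfin _ hF,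
      ENNReal.ofReal_mul hα]
  have hU : A = ⋃ k, A ∩ spanningSets m k := by
    rw [← Set.inter_iUnion, iUnion_spanningSets, Set.inter_univ]
  have hmon : Monotone fun k => A ∩ spanningSets m k :=
    fun i j hij => Set.inter_subset_inter_right A (monotone_spanningSets m hij)
  rw [hU, hmon.measure_iUnion, hmon.measure_iUnion, ENNReal.mul_iSup]
  exact iSup_congr hE

end OrderedMeasures

namespace ExtendedSignedMeasure

/-! ### Extended-real sums, negation and Hahn decomposition -/

lemma neg_finset_sum {ι : Type*} {x : ι → EReal} (h : (∀ i, x i ≠ ⊤) ∨ ∀ i, x i ≠ ⊥)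
    (s : Finset ι) : -∑ i ∈ s, x i = ∑ i ∈ s, -x i := by
  classical
  rcases h with h | h
  · refine (?_ : -∑ i ∈ s, x i = ∑ i ∈ s, -x i ∧ ∑ i ∈ s, x i ≠ ⊤).1
    induction s using Finset.induction_on with
    | empty => simp
    | insert a s ha ih =>
      rw [Finset.sum_insert ha, Finset.sum_insert ha,
        EReal.neg_add (.inr ih.2) (.inl (h a)), sub_eq_add_neg, ih.1]
      exact ⟨rfl, EReal.add_ne_top (h a) ih.2⟩
  · refine (?_ : -∑ i ∈ s, x i = ∑ i ∈ s, -x i ∧ ∑ i ∈ s, x i ≠ ⊥).1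
    induction s using Finset.induction_on with
    | empty => simp
    | insert a s ha ih =>
      rw [Finset.sum_insert ha, Finset.sum_insert ha,
        EReal.neg_add (.inl (h a)) (.inr ih.2), sub_eq_add_neg, ih.1]
      exact ⟨rfl, by simp [EReal.add_eq_bot_iff, h a, ih.2]⟩

lemma toENNReal_finset_sum {ι : Type*} {x : ι → EReal} (h : ∀ i, 0 ≤ x i) (s : Finset ι) :
    (∑ i ∈ s, x i).toENNReal = ∑ i ∈ s, (x i).toENNReal := by
  classical
  induction s using Finset.induction_on with
  | empty => simp
  | insert a s ha ih =>
    rw [Finset.sum_insert ha, Finset.sum_insert ha,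
      EReal.toENNReal_add (h a) (Finset.sum_nonneg fun i _ => h i), ih]

lemma coe_finset_sum {ι : Type*} (x : ι → ℝ) (s : Finset ι) :
    ((∑ i ∈ s, x i : ℝ) : EReal) = ∑ i ∈ s, (x i : EReal) := by
  classical
  induction s using Finset.induction_on with
  | empty => simp
  | insert a s ha ih => rw [Finset.sum_insert ha, Finset.sum_insert ha, EReal.coe_add, ih]

/-- The set `A` with its part in `N` replaced by the complement in `N`. -/
def flipOn {Ω : Type*} (N A : Set Ω) : Set Ω := (A ∩ Nᶜ) ∪ (Aᶜ ∩ N)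

lemma flipOn_flipOn {Ω : Type*} (N A : Set Ω) : flipOn N (flipOn N A) = A := by
  ext x
  simp only [flipOn, Set.mem_union, Set.mem_inter_iff, Set.mem_compl_iff]
  tauto

variable {Ω : Type*} [MeasurableSpace Ω]

/-- The negative of an extended signed measure omitting one of the values `±∞`. -/
noncomputable def negate (μ : VectorMeasure Ω EReal) (h : (∀ A, μ A ≠ ⊤) ∨ ∀ A, μ A ≠ ⊥) :
    VectorMeasure Ω EReal where
  measureOf' A := -μ A
  empty' := by simp
  not_measurable' A hA := by simp [μ.not_measurable hA]
  m_iUnion' f hf hd := by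
    have := (continuous_neg.tendsto _).comp (μ.m_iUnion hf hd)
    refine this.congr fun s => neg_finset_sum ?_ s
    exact h.imp (fun h i => h _) (fun h i => h _)

lemma negate_apply (μ : VectorMeasure Ω EReal) (h : (∀ A, μ A ≠ ⊤) ∨ ∀ A, μ A ≠ ⊥) (A : Set Ω) :
    negate μ h A = -μ A := rfl

lemma totalVariation_negate (μ : VectorMeasure Ω EReal)
    (h : (∀ A, μ A ≠ ⊤) ∨ ∀ A, μ A ≠ ⊥) :
    totalVariation (negate μ h) = totalVariation μ := by
  unfold totalVariation
  congr 1
  funext A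
  rw [negate_apply, EReal.abs_neg]

/-- The measure given by an extended signed measure on a set all of whose subsets have nonnegative
measure. -/
noncomputable def toMeasureOn (μ : VectorMeasure Ω EReal) (S : Set Ω) (hS : MeasurableSet S)
    (h : ∀ A, MeasurableSet A → 0 ≤ μ (A ∩ S)) : Measure Ω :=
  Measure.ofMeasurable (fun A _ => (μ (A ∩ S)).toENNReal) (by simp) fun f hf hd => by
    have h1 := μ.m_iUnion (f := fun i => f i ∩ S) (fun i => (hf i).inter hS)
      fun i j hij => (hd hij).mono Set.inter_subset_left Set.inter_subset_left
    rw [← Set.iUnion_inter] at h1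
    have h2 : HasSum (fun i => (μ (f i ∩ S)).toENNReal) (μ ((⋃ i, f i) ∩ S)).toENNReal :=
      ((EReal.continuous_toENNReal.tendsto _).comp h1).congr fun s =>
        toENNReal_finset_sum (fun i => h _ (hf i)) s
    exact h2.tsum_eq.symm

lemma coe_toMeasureOn (μ : VectorMeasure Ω EReal) {S : Set Ω} (hS : MeasurableSet S)
    (h : ∀ A, MeasurableSet A → 0 ≤ μ (A ∩ S)) {A : Set Ω} (hA : MeasurableSet A) :
    (toMeasureOn μ S hS h A : EReal) = μ (A ∩ S) := by
  rw [toMeasureOn, Measure.ofMeasurable_apply A hA, EReal.coe_toENNReal (h A hA)]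

lemma exists_signedMeasure (μ : VectorMeasure Ω EReal) {E : Set Ω} (hE : MeasurableSet E)
    (hfin : ∀ A ⊆ E, MeasurableSet A → μ A ≠ ⊤ ∧ μ A ≠ ⊥) :
    ∃ s : SignedMeasure Ω, ∀ A, MeasurableSet A → (s A : EReal) = μ (A ∩ E) := by
  have hcoe : ∀ A, MeasurableSet A → ((μ.restrict E A).toReal : EReal) = μ.restrict E A := by
    intro A hA
    rw [μ.restrict_apply hE hA]
    have := hfin _ Set.inter_subset_right (hA.inter hE)
    exact EReal.coe_toReal this.1 this.2
  refine ⟨⟨fun A => (μ.restrict E A).toReal, by simp, fun A hA => by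
    simp [VectorMeasure.not_measurable _ hA], fun f hf hd => ?_⟩, fun A hA => ?_⟩
  · have h1 := (μ.restrict E).m_iUnion hf hd
    rw [← hcoe _ (.iUnion hf)] at h1
    refine EReal.tendsto_coe.1 (h1.congr fun s => ?_)
    rw [coe_finset_sum]
    exact Finset.sum_congr rfl fun i _ => (hcoe _ (hf i)).symm
  · rw [← μ.restrict_apply hE hA]
    exact hcoe A hA

lemma abs_le_totalVariation (μ : VectorMeasure Ω EReal) {A : Set Ω} (hA : MeasurableSet A) :
    (μ A).abs ≤ totalVariation μ A := by
  rw [totalVariation, preVariation_apply, VectorMeasure.ennrealToMeasure_apply hA,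
    ennrealPreVariation_apply]
  by_cases h0 : (⟨A, hA⟩ : Subtype MeasurableSet) = ⊥
  · have : A = ∅ := congrArg Subtype.val h0
    simp [this]
  · simpa using preVariation.sum_le (fun A : Set Ω => (μ A).abs) hA (Finpartition.indiscrete h0)

/-- The Hahn decomposition of a σ-finite extended signed measure. -/
theorem exists_hahn (μ : VectorMeasure Ω EReal) [SigmaFinite (totalVariation μ)] :
    ∃ N, MeasurableSet N ∧ (∀ A, MeasurableSet A → 0 ≤ μ (A ∩ Nᶜ)) ∧
      ∀ A, MeasurableSet A → μ (A ∩ N) ≤ 0 := by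
  -- On each disjoint piece of finite variation `μ` is a real signed measure; the classical Hahn
  -- sets of the pieces are glued.
  set E := disjointed (spanningSets (totalVariation μ)) with hEdef
  have hE : ∀ k, MeasurableSet (E k) := .disjointed (measurableSet_spanningSets _)
  have hEd : Pairwise (Function.onFun Disjoint E) := disjoint_disjointed _
  have hEU : ⋃ k, E k = Set.univ := by
    rw [hEdef, iUnion_disjointed, iUnion_spanningSets]
  have hfin : ∀ k, ∀ A ⊆ E k, MeasurableSet A → μ A ≠ ⊤ ∧ μ A ≠ ⊥ := by
    intro k A hAE hA
    have h1 : (μ A).abs < ∞ := (abs_le_totalVariation μ hA).trans_lt <|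
      (measure_mono (hAE.trans (disjointed_subset _ k))).trans_lt
        (measure_spanningSets_lt_top _ k)
    constructor <;> intro h <;> simp [h] at h1
  choose s hs using fun k => exists_signedMeasure μ (hE k) (hfin k)
  choose P hP hpos hneg using fun k => (s k).exists_compl_positive_negative
  have hU : ∀ A Q : Set Ω, ∀ R : ℕ → Set Ω, (∀ k, Q ∩ E k = R k ∩ E k) →
      A ∩ Q = ⋃ k, (A ∩ R k) ∩ E k := by
    intro A Q R h
    have : ∀ k, (A ∩ R k) ∩ E k = (A ∩ Q) ∩ E k := fun k => by
      rw [Set.inter_assoc, ← h, Set.inter_assoc]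
    simp_rw [this]
    rw [← Set.inter_iUnion, hEU, Set.inter_univ]
  have hNE : ∀ k, (⋃ j, (P j)ᶜ ∩ E j) ∩ E k = (P k)ᶜ ∩ E k := by
    intro k
    ext x
    simp only [Set.mem_inter_iff, Set.mem_iUnion]
    constructor
    · rintro ⟨⟨j, hj, hxj⟩, hxk⟩
      have : j = k := hEd.eq (Set.not_disjoint_iff.2 ⟨x, hxj, hxk⟩)
      subst this
      exact ⟨hj, hxj⟩
    · exact fun h => ⟨⟨k, h⟩, h.2⟩
  have hNcE : ∀ k, (⋃ j, (P j)ᶜ ∩ E j)ᶜ ∩ E k = P k ∩ E k := by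
    intro k
    ext x
    have := Set.ext_iff.1 (hNE k) x
    simp only [Set.mem_inter_iff, Set.mem_compl_iff] at this ⊢
    tauto
  have hsum : ∀ (A : Set Ω) (R : ℕ → Set Ω), MeasurableSet A → (∀ k, MeasurableSet (R k)) →
      HasSum (fun k => ((s k (A ∩ R k) : ℝ) : EReal)) (μ (⋃ k, (A ∩ R k) ∩ E k)) := by
    intro A R hA hR
    have := μ.m_iUnion (f := fun k => (A ∩ R k) ∩ E k) (fun k => (hA.inter (hR k)).inter (hE k))
      fun i j hij => (hEd hij).mono Set.inter_subset_right Set.inter_subset_right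
    simpa only [hs _ _ (hA.inter (hR _))] using this
  refine ⟨⋃ k, (P k)ᶜ ∩ E k, .iUnion fun k => (hP k).compl.inter (hE k), fun A hA => ?_,
    fun A hA => ?_⟩
  · rw [hU A _ P hNcE]
    refine ge_of_tendsto' (hsum A P hA hP) fun t => Finset.sum_nonneg fun k _ => ?_
    exact EReal.coe_nonneg.2 (VectorMeasure.subset_le_of_restrict_le_restrict 0 (s k) (hP k)
      (hpos k) Set.inter_subset_right)
  · rw [hU A _ (fun k => (P k)ᶜ) hNE]
    refine le_of_tendsto' (hsum A _ hA fun k => (hP k).compl)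
      fun t => Finset.sum_nonpos fun k _ => ?_
    exact EReal.coe_nonpos.2 (VectorMeasure.subset_le_of_restrict_le_restrict (s k) 0 (hP k).compl
      (hneg k) Set.inter_subset_right)

/-! ### Reduction to positive measures by flipping -/

lemma measurableSet_flipOn {N A : Set Ω} (hN : MeasurableSet N) (hA : MeasurableSet A) :
    MeasurableSet (flipOn N A) := (hA.inter hN.compl).union (hA.compl.inter hN)

/-- `a` and `b` are the positive and negative parts of `v`, with respect to the set `N`; the
negative part is finite. -/
structure IsHahnDecomposition (v : VectorMeasure Ω EReal) (N : Set Ω) (a b : Measure Ω) :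
    Prop where
  measurableSet : MeasurableSet N
  pos : ∀ A, MeasurableSet A → v (A ∩ Nᶜ) = a A
  neg : ∀ A, MeasurableSet A → v (A ∩ N) = -(b A : EReal)
  ne_top : b Set.univ ≠ ∞

namespace IsHahnDecomposition

variable {v w : VectorMeasure Ω EReal} {N A : Set Ω} {a b a' b' : Measure Ω}

lemma apply_eq (h : IsHahnDecomposition v N a b) (hA : MeasurableSet A) :
    v A = (a A : EReal) + -(b A : EReal) := by
  have hd : Disjoint (A ∩ Nᶜ) (A ∩ N) :=
    disjoint_compl_left.mono Set.inter_subset_right Set.inter_subset_right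
  rw [← h.pos A hA, ← h.neg A hA,
    ← v.of_union hd (hA.inter h.measurableSet.compl) (hA.inter h.measurableSet), Set.union_comm,
    Set.inter_union_compl]

/-- Flipping replaces the contribution `-b A` by `-b Aᶜ`, which is `b A - b univ` since `b` is
finite. -/
lemma apply_flipOn (h : IsHahnDecomposition v N a b) (hA : MeasurableSet A) :
    v (flipOn N A) = ((a + b) A : EReal) - ((b Set.univ).toReal : ℝ) := by
  have h1 : v (flipOn N A) = (a A : EReal) + -(b Aᶜ : EReal) := by
    have hd : Disjoint (A ∩ Nᶜ) (Aᶜ ∩ N) :=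
      disjoint_compl_left.mono Set.inter_subset_right Set.inter_subset_right
    rw [← h.pos A hA, ← h.neg _ hA.compl, flipOn,
      v.of_union hd (hA.inter h.measurableSet.compl) (hA.compl.inter h.measurableSet)]
  have h2 : b A ≠ ∞ := measure_ne_top_of_subset (Set.subset_univ _) h.ne_top
  have h3 : b Aᶜ ≠ ∞ := measure_ne_top_of_subset (Set.subset_univ _) h.ne_top
  rw [h1, ← measure_add_measure_compl hA, Measure.add_apply]
  lift b A to NNReal using h2 with x
  lift b Aᶜ to NNReal using h3 with y
  cases a A with
  | top =>
    rw [top_add, EReal.coe_ennreal_top, EReal.top_sub_coe]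
    exact EReal.top_add_coe (-(y : ℝ))
  | coe z =>
    have : ((z : ℝ) : EReal) + -((y : ℝ) : EReal) =
        ((z + x : ℝ) : EReal) - ((x + y : ℝ) : EReal) := by
      norm_cast
      push_cast
      ring
    rw [← ENNReal.coe_add z x, ENNReal.toReal_add ENNReal.coe_ne_top ENNReal.coe_ne_top]
    exact this

lemma orderCompatible (hv : IsHahnDecomposition v N a b) (hw : IsHahnDecomposition w N a' b')
    (hO : ConditionO v w) (hrange : (measureRange v).OrdConnected) :
    OrderedMeasures.OrderCompatible (a + b) (a' + b') where
  mono A B hA hB hAB := by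
    have h1 := hO.2 _ _ (measurableSet_flipOn hv.measurableSet hA)
      (measurableSet_flipOn hv.measurableSet hB) (by
        rw [hv.apply_flipOn hA, hv.apply_flipOn hB]
        exact EReal.sub_le_sub (EReal.coe_ennreal_le_coe_ennreal_iff.2 hAB) le_rfl)
    rw [hw.apply_flipOn hA, hw.apply_flipOn hB] at h1
    have h2 := add_le_add_left h1 (((b' Set.univ).toReal : ℝ) : EReal)
    rw [EReal.sub_add_cancel, EReal.sub_add_cancel] at h2
    exact EReal.coe_ennreal_le_coe_ennreal_iff.1 h2
  ne_top A hA hA' := by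
    have h1 := hv.apply_flipOn hA
    rw [← EReal.coe_ennreal_toReal hA', ← EReal.coe_sub] at h1
    have h2 := (hO.1 _ _ (measurableSet_flipOn hv.measurableSet hA)
      (measurableSet_flipOn hv.measurableSet hA) rfl (h1 ▸ EReal.coe_ne_top _)
      (h1 ▸ EReal.coe_ne_bot _)).2.1
    intro h3
    rw [hw.apply_flipOn hA, h3] at h2
    simp at h2
  exists_eq A t hA ht := by
    have hmem : ((t : EReal) - ((b Set.univ).toReal : ℝ)) ∈ measureRange v := by
      refine hrange.out ⟨_, measurableSet_flipOn hv.measurableSet .empty, rfl⟩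
        ⟨_, measurableSet_flipOn hv.measurableSet hA, rfl⟩ ⟨?_, ?_⟩
      · rw [hv.apply_flipOn .empty]
        exact EReal.sub_le_sub (by simp [EReal.coe_ennreal_nonneg]) le_rfl
      · rw [hv.apply_flipOn hA]
        exact EReal.sub_le_sub (EReal.coe_ennreal_le_coe_ennreal_iff.2 ht) le_rfl
    obtain ⟨B, hB, hBt⟩ := hmem
    have hB' := measurableSet_flipOn hv.measurableSet hB
    -- Flipping is an involution, so flipping `B` recovers a set whose `a + b` value is `t`.
    refine ⟨flipOn N B, hB', ?_⟩
    have h1 := hv.apply_flipOn hB'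
    rw [flipOn_flipOn, hBt] at h1
    have h2 := congrArg (· + (((b Set.univ).toReal : ℝ) : EReal)) h1
    simp only [EReal.sub_add_cancel] at h2
    exact (EReal.coe_ennreal_injective h2).symm

lemma exists_eq_mul (hv : IsHahnDecomposition v N a b) (hw : IsHahnDecomposition w N a' b')
    [SigmaFinite (a + b)] (hO : ConditionO v w) (hrange : (measureRange v).OrdConnected) :
    ∃ α : ℝ, ∀ A, MeasurableSet A → w A = (α : EReal) * v A := by
  obtain ⟨α, hα, h⟩ := (hv.orderCompatible hw hO hrange).exists_eq_smul
  have hN := hv.measurableSet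
  have ha0 : ∀ {v : VectorMeasure Ω EReal} {a b : Measure Ω}, IsHahnDecomposition v N a b →
      a N = 0 ∧ b Nᶜ = 0 := by
    intro v a b h
    have h1 := h.pos N hN
    have h2 := h.neg Nᶜ hN.compl
    simp only [Set.inter_compl_self, Set.compl_inter_self, VectorMeasure.empty] at h1 h2
    exact ⟨by simpa using h1.symm, by simpa using h2.symm⟩
  refine ⟨α, fun A hA => ?_⟩
  have hsplit : ∀ {v : VectorMeasure Ω EReal} {a b : Measure Ω}, IsHahnDecomposition v N a b →
      (a + b) (A ∩ Nᶜ) = a A ∧ (a + b) (A ∩ N) = b A := by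
    intro v a b h
    obtain ⟨h1, h2⟩ := ha0 h
    have e1 := measure_inter_add_sdiff (μ := a) A hN
    have e2 := measure_inter_add_sdiff (μ := b) A hN
    rw [Set.sdiff_eq] at e1 e2
    rw [measure_mono_null Set.inter_subset_right h1, zero_add] at e1
    rw [measure_mono_null (s := A ∩ Nᶜ) Set.inter_subset_right h2, add_zero] at e2
    rw [Measure.add_apply, Measure.add_apply, e1, e2, measure_mono_null Set.inter_subset_right h1,
      measure_mono_null (s := A ∩ Nᶜ) Set.inter_subset_right h2, zero_add, add_zero]
    exact ⟨rfl, rfl⟩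
  have h1 := h _ (hA.inter hN.compl)
  have h2 := h _ (hA.inter hN)
  rw [(hsplit hv).1, (hsplit hw).1] at h1
  rw [(hsplit hv).2, (hsplit hw).2] at h2
  have hα' : ((ENNReal.ofReal α : ℝ≥0∞) : EReal) = α := by
    rw [EReal.coe_ennreal_ofReal, max_eq_left hα]
  rw [hv.apply_eq hA, hw.apply_eq hA, h1, h2, EReal.coe_ennreal_mul, EReal.coe_ennreal_mul, hα',
    EReal.left_distrib_of_nonneg_of_ne_top (EReal.coe_nonneg.2 hα) (EReal.coe_ne_top α), mul_neg]

end IsHahnDecomposition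

lemma exists_eq_mul_of_ne_bot (μ ν : VectorMeasure Ω EReal) (hμ : IsSigmaFiniteSigned μ)
    (hν : IsSigmaFiniteSigned ν) (hO : ConditionO μ ν) (hrange : (measureRange μ).OrdConnected)
    (hbot : ∀ A, μ A ≠ ⊥) :
    ∃ α : ℝ, ∀ A, MeasurableSet A → ν A = (α : EReal) * μ A := by
  have := hμ.2
  obtain ⟨N, hN, hpos, hneg⟩ := exists_hahn μ
  have hpos' : ∀ A, MeasurableSet A → 0 ≤ ν (A ∩ Nᶜ) := fun A hA => by
    simpa using hO.2 ∅ _ .empty (hA.inter hN.compl) (by simpa using hpos A hA)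
  have hneg' : ∀ A, MeasurableSet A → ν (A ∩ N) ≤ 0 := fun A hA => by
    simpa using hO.2 _ ∅ (hA.inter hN) .empty (by simpa using hneg A hA)
  -- Finiteness of `μ N` passes to `ν N` through condition (L), making both negative parts finite.
  have hμN : μ N ≠ ⊤ ∧ μ N ≠ ⊥ := by
    refine ⟨fun h => ?_, hbot N⟩
    have := hneg N hN
    simp [h] at this
  have hνN := (hO.1 N N hN hN rfl hμN.1 hμN.2).2
  have hdec : ∀ (v : VectorMeasure Ω EReal) (hv : (∀ A, v A ≠ ⊤) ∨ ∀ A, v A ≠ ⊥)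
      (hp : ∀ A, MeasurableSet A → 0 ≤ v (A ∩ Nᶜ))
      (hn : ∀ A, MeasurableSet A → v (A ∩ N) ≤ 0), v N ≠ ⊥ →
      IsHahnDecomposition v N (toMeasureOn v Nᶜ hN.compl hp)
        (toMeasureOn (negate v hv) N hN fun A hA => by simpa [negate_apply] using hn A hA) := by
    intro v hv hp hn hvN
    have hb := fun A (hA : MeasurableSet A) => coe_toMeasureOn (negate v hv) hN
      (fun A hA => by simpa [negate_apply] using hn A hA) hA
    refine ⟨hN, fun A hA => (coe_toMeasureOn v hN.compl hp hA).symm, fun A hA => ?_, ?_⟩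
    · rw [hb A hA, negate_apply, neg_neg]
    · intro h
      have := hb Set.univ .univ
      rw [h, Set.univ_inter, negate_apply] at this
      simp only [EReal.coe_ennreal_top] at this
      exact hvN (by rw [← neg_neg (v N), ← this]; rfl)
  have hdμ := hdec μ hμ.1 hpos hneg hμN.2
  have hdν := hdec ν hν.1 hpos' hneg' hνN.2
  set a := toMeasureOn μ Nᶜ hN.compl hpos
  set b := toMeasureOn (negate μ hμ.1) N hN fun A hA => by simpa [negate_apply] using hneg A hA
  have : SigmaFinite (a + b) := by
    refine ⟨⟨⟨spanningSets (totalVariation μ), fun _ => trivial, fun k => ?_,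
      iUnion_spanningSets _⟩⟩⟩
    have hk := measurableSet_spanningSets (totalVariation μ) k
    rw [Measure.add_apply]
    refine ENNReal.add_lt_top.2 ⟨?_, ?_⟩
    · refine lt_top_iff_ne_top.2 fun h => ?_
      have h1 := hdμ.pos _ hk
      rw [h, EReal.coe_ennreal_top] at h1
      have h2 := (abs_le_totalVariation μ (hk.inter hN.compl)).trans
        (measure_mono Set.inter_subset_left)
      rw [h1, EReal.abs_top, top_le_iff] at h2
      exact (measure_spanningSets_lt_top _ k).ne h2
    · exact (measure_mono (Set.subset_univ _)).trans_lt hdμ.ne_top.lt_top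
  exact hdμ.exists_eq_mul hdν hO hrange

end ExtendedSignedMeasure

theorem corollary3p6 {Ω : Type*} [MeasurableSpace Ω] (μ ν : VectorMeasure Ω EReal)
    (hμ : ExtendedSignedMeasure.IsSigmaFiniteSigned μ)
    (hν : ExtendedSignedMeasure.IsSigmaFiniteSigned ν)
    (hO : ExtendedSignedMeasure.ConditionO μ ν)
    (hrange : (ExtendedSignedMeasure.measureRange μ).OrdConnected) :
    ∃ α : ℝ, ∀ A : Set Ω, MeasurableSet A → ν A = (α : EReal) * μ A := by
  open ExtendedSignedMeasure in
  rcases hμ.1 with h | h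
  -- If `⊤` is omitted, negate both measures: the hypotheses are preserved and the same `α` works.
  · have hneg : ∀ (v : VectorMeasure Ω EReal) (hv : IsSigmaFiniteSigned v),
        IsSigmaFiniteSigned (negate v hv.1) := by
      intro v hv
      refine ⟨hv.1.symm.imp (fun h A => ?_) (fun h A => ?_), ?_⟩
      · rw [negate_apply, Ne, EReal.neg_eq_top_iff]; exact h A
      · rw [negate_apply, Ne, EReal.neg_eq_bot_iff]; exact h A
      · rw [totalVariation_negate]; exact hv.2
    have hO' : ConditionO (negate μ hμ.1) (negate ν hν.1) := by
      refine ⟨fun A B hA hB hAB h1 h2 => ?_, fun A B hA hB hAB => ?_⟩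
      · simp only [negate_apply, Ne, EReal.neg_eq_top_iff, EReal.neg_eq_bot_iff, neg_inj]
          at hAB h1 h2 ⊢
        have := hO.1 A B hA hB hAB h2 h1
        exact ⟨this.1, this.2.2, this.2.1⟩
      · simp only [negate_apply, EReal.neg_le_neg_iff] at hAB ⊢
        exact hO.2 B A hB hA hAB
    have hrange' : (measureRange (negate μ hμ.1)).OrdConnected := by
      refine ⟨?_⟩
      rintro _ ⟨A, hA, rfl⟩ _ ⟨B, hB, rfl⟩ z ⟨h1, h2⟩
      rw [negate_apply] at h1 h2
      obtain ⟨C, hC, hCz⟩ := hrange.out ⟨B, hB, rfl⟩ ⟨A, hA, rfl⟩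
        ⟨EReal.le_neg_of_le_neg h2, EReal.neg_le_of_neg_le h1⟩
      exact ⟨C, hC, by rw [negate_apply, hCz, neg_neg]⟩
    obtain ⟨α, hα⟩ := exists_eq_mul_of_ne_bot (negate μ hμ.1) (negate ν hν.1) (hneg μ hμ)
      (hneg ν hν) hO' hrange' fun A => by
        rw [negate_apply, Ne, EReal.neg_eq_bot_iff]
        exact h A
    refine ⟨α, fun A hA => ?_⟩
    have := hα A hA
    rwa [negate_apply, negate_apply, mul_neg, neg_inj] at this
  · exact exists_eq_mul_of_ne_bot μ ν hμ hν hO hrange h
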